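/- Let $G=(V,E)$ be the 5-cycle with vertices (classes) $1,\dots,5$ and edges $1-2$, $2-3$, $3-4$, $4-5$, $5-1$. In the matching model, i.i.d. items of law $\mu$ on $V$ arrive one by one at an initially empty buffer, whose content is a word over $V$. An arriving item is matched with an item of an adjacent class in the buffer, which is then removed, if there is one, and otherwise it is appended to the buffer; a matching policy $\Phi$ decides which item is removed as a function of the current buffer content and of the class of the arriving item. A priority policy is given by a strict total order (preferences) on the neighbours of each class $i$: an arriving item of class $i$ is matched with an item of its most preferred class among the adjacent classes present in the buffer. The model $(G,\Phi,\mu)$ is stable if the Markov chain $(U_n)_{n\ge 0}$ of the buffer contents is positive recurrent, and unstable otherwise. Let $\mathrm{Ncond}(G)$ be the set of probability measures $\mu$ on $V$ with $\mu(i)>0$ for all $i$ and $\mu(F)<\mu(\{v : v \text{ is adjacent to some } u\in F\})$ for every non-empty independent set $F\subset V$. Then there are a measure $\mu\in\mathrm{Ncond}(G)$ and a priority policy $\Phi$ such that $(G,\Phi,\mu)$ is unstable. More precisely, priority policies exist for which class $2$ prefers class $3$ to class $1$ and class $5$ prefers class $4$ to class $1$, and for every $0<\varepsilon<2/9$ the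 values $$\mu(1)=\tfrac12-\tfrac{3\varepsilon}{4},\qquad \mu(2)=\mu(5)=\tfrac14-\tfrac{\varepsilon}{8},\qquad \mu(3)=\mu(4)=\tfrac{\varepsilon}{2}$$ define a measure $\mu\in\mathrm{Ncond}(G)$ such that, for every such priority policy $\Phi$ (whatever its other priority rules): 1. $(G,\Phi,\mu)$ is unstable; 2. the Markov chain $(U_n)$ is transient, i.e. from every state the probability of returning to it is less than $1$; 3. a buffer that contains an item of class $1$ contains only items of classes $1,3,4$, and from such a buffer the pair $(x,y)$, where $x$ is the number of items of class $1$ and $y$ the number of items of classes $3$ and $4$, moves as a quarter-plane random walk: its jumps are $(1,0)$, $(-1,0)$, $(0,1)$, $(0,-1)$ with respective probabilities $\tfrac12-\tfrac{3\varepsilon}4,\ \tfrac14-\tfrac{\varepsilon}8,\ \tfrac{\varepsilon}2,\ \tfrac14+\tfrac{3\varepsilon}8$ if $y>0$, and $\tfrac12-\tfrac{3\varepsilon}4,\ \tfrac12-\tfrac{\varepsilon}4,\ \varepsilon,\ 0$ if $y=0$; 4. with positive probability, the chain started from the empty buffer contains an item of class $1$ at all sufficiently late times, i.e. it stays in this component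 for ever. -/

import Mathlib

open MeasureTheory
open scoped ENNReal

/-- The buffer contents: words over the classes in which no two classes joined by an edge
both occur. -/
def Buffer {V : Type*} [DecidableEq V] (G : SimpleGraph V) : Type _ :=
  {u : List V // ∀ i j, G.Adj i j → u.count i * u.count j = 0}

/-- The empty buffer. -/
def Buffer.empty {V : Type*} [DecidableEq V] (G : SimpleGraph V) : Buffer G :=
  ⟨[], by simp⟩

/-- A matching policy: `next u v` is the buffer content after the arrival of an item of class `v`
in a buffer of content `u`. If no item of the buffer is compatible with `v`, then `v` is stored;
otherwise exactly one item of the buffer that is compatible with `v` is removed, together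
with `v`. -/
structure MatchingPolicy {V : Type*} [DecidableEq V] (G : SimpleGraph V) where
  next : Buffer G → V → Buffer G
  next_of_unmatched : ∀ (u : Buffer G) (v : V),
    (∀ j ∈ u.1, ¬ G.Adj v j) → (next u v).1 = u.1 ++ [v]
  next_of_matched : ∀ (u : Buffer G) (v : V), (∃ j ∈ u.1, G.Adj v j) →
    ∃ (l : List V) (j : V) (r : List V),
      u.1 = l ++ j :: r ∧ G.Adj v j ∧ (next u v).1 = l ++ r

/-- Preferences: for every class `i`, a strict total order on the set of the neighbours of `i`.
`lt i j k` means that `i` gives priority to `k` over `j`. -/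
structure Preferences {V : Type*} (G : SimpleGraph V) where
  lt : V → V → V → Prop
  strictTotal : ∀ i, IsStrictTotalOrder (G.neighborSet i) (fun j k => lt i j k)

/-- `Φ` is a priority policy for the given preferences: an arriving item of class `v` that can be
matched is matched with an item of the class that `v` prefers among the compatible classes
present in the buffer. -/
def MatchingPolicy.IsPriority {V : Type*} [DecidableEq V] {G : SimpleGraph V}
    (Φ : MatchingPolicy G) (pref : Preferences G) : Prop :=
  ∀ (u : Buffer G) (v j : V), j ∈ u.1 → G.Adj v j →
    (∀ k ∈ u.1, G.Adj v k → k = j ∨ pref.lt v k j) →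
    ((Φ.next u v).1 : Multiset V) = (u.1 : Multiset V).erase j

/-- The set `Ncond` of the probability measures `μ` charging every class such that
`μ(F) < μ(E(F))` for every non-empty independent set `F`, where `E(F)` is the set of the classes
with a neighbour in `F`. -/
def Ncond {V : Type*} [MeasurableSpace V] (G : SimpleGraph V) : Set (PMF V) :=
  {μ | (∀ i, 0 < μ i) ∧ ∀ F : Set V, F.Nonempty → G.IsIndepSet F →
    μ.toMeasure F < μ.toMeasure {v | ∃ u ∈ F, G.Adj u v}}

/-- The sequence of buffer contents started from `u`, for the sequence of arrivals `ω`. -/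
def MatchingPolicy.chain {V : Type*} [DecidableEq V] {G : SimpleGraph V}
    (Φ : MatchingPolicy G) (u : Buffer G) (ω : ℕ → V) : ℕ → Buffer G
  | 0 => u
  | n + 1 => Φ.next (Φ.chain u ω n) (ω n)

/-- The law of an i.i.d. sequence of arrivals of common law `μ`. -/
noncomputable def arrivalLaw {V : Type*} [MeasurableSpace V] (μ : PMF V) : Measure (ℕ → V) :=
  Measure.infinitePi (fun _ : ℕ => μ.toMeasure)

/-- The first return time to the initial state `u` (infinite if there is no return). -/
noncomputable def MatchingPolicy.returnTime {V : Type*} [DecidableEq V] {G : SimpleGraph V}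
    (Φ : MatchingPolicy G) (u : Buffer G) (ω : ℕ → V) : ℝ≥0∞ :=
  ⨅ (n : ℕ) (_ : 1 ≤ n ∧ Φ.chain u ω n = u), (n : ℝ≥0∞)

/-- The matching model `(G, Φ, μ)` is stable: the Markov chain of the buffer contents is positive
recurrent, that is, the expected return time to every state is finite. -/
def MatchingPolicy.Stable {V : Type*} [DecidableEq V] [MeasurableSpace V] {G : SimpleGraph V}
    (Φ : MatchingPolicy G) (μ : PMF V) : Prop :=
  ∀ u : Buffer G, ∫⁻ ω, Φ.returnTime u ω ∂(arrivalLaw μ) < ∞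

/-- The Markov chain of the buffer contents is transient: from every state, the probability to
return to it is less than one. -/
def MatchingPolicy.Transient {V : Type*} [DecidableEq V] [MeasurableSpace V] {G : SimpleGraph V}
    (Φ : MatchingPolicy G) (μ : PMF V) : Prop :=
  ∀ u : Buffer G, arrivalLaw μ {ω | ∃ n, 1 ≤ n ∧ Φ.chain u ω n = u} < 1

/-- The cycle of length 5. The vertices `0, 1, 2, 3, 4` are the classes 1, 2, 3, 4, 5. -/
abbrev fiveCycle : SimpleGraph (Fin 5) := SimpleGraph.cycleGraph 5

/-- The masses of the classes 1, 2, 3, 4, 5. -/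
noncomputable def fiveCycleMass (ε : ℝ) : Fin 5 → ℝ :=
  ![1 / 2 - 3 * ε / 4, 1 / 4 - ε / 8, ε / 2, ε / 2, 1 / 4 - ε / 8]

/-- The position `(x, y)` in the quarter plane: `x` is the number of items of class 1 and `y` the
number of items of class 3 or 4. -/
def quarterPosition (u : Buffer fiveCycle) : ℤ × ℤ :=
  ((u.1.count 0 : ℤ), (u.1.count 2 : ℤ) + (u.1.count 3 : ℤ))

/-- The probability that the quarter-plane walk jumps by `d` from a point `(x, y)` with `0 < x`:
one jump law on the first axis `y = 0`, another one in the interior `0 < y`. -/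
noncomputable def quarterJump (ε : ℝ) (y : ℤ) (d : ℤ × ℤ) : ℝ :=
  if y = 0 then
    if d = (1, 0) then 1 / 2 - 3 * ε / 4
    else if d = (-1, 0) then 1 / 2 - ε / 4
    else if d = (0, 1) then ε
    else 0
  else
    if d = (1, 0) then 1 / 2 - 3 * ε / 4
    else if d = (-1, 0) then 1 / 4 - ε / 8
    else if d = (0, 1) then ε / 2
    else if d = (0, -1) then 1 / 4 + 3 * ε / 8
    else 0

/-! While class 1 is present, the position `(x, y)` is a quarter-plane walk. For `y > 0` the
preferences of classes 2 and 5 divert arrivals from class 1 to classes 3 and 4: `x` has drift `1/4 -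
5ε/8 > 0` and `y` has drift `-(1/4 - ε/8)`. On the axis `x` has drift `-ε/2`, but `y` is pushed up
at rate `ε`. The gain made during excursions off the axis outweighs the loss on it exactly when `ε <
2/9`.

This is made quantitative by `lyapunov`, the function `f = s ^ x * (1 + κ * r ^ y)`, superharmonic
as long as class 1 is present (`exists_isLyapunov`, `IsLyapunov.sum_le`). Without class 1, `x = 0`
and `f ≥ 1`. For `m ≤ 1`, the maximal inequality `MatchingPolicy.visitProb_le_div` bounds the
probability of ever reaching `f ≥ m` by `f / m`, which is less than 1 when `f < m` at the start. A
run of class 1 arrivals has positive probability and makes `f` arbitrarily small, from any buffer.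
Taking `m ≤ f u` gives transience at `u`, hence instability; taking `m = 1` gives a positive
probability that class 1 never disappears. -/

/-- The sequence whose first term is `v` and whose other terms are those of `ω`. -/
def consSeq {V : Type*} (v : V) (ω : ℕ → V) : ℕ → V
  | 0 => v
  | n + 1 => ω n

/-- A weighted mean of numbers at most one that equals one has no smaller term of positive
weight. -/
theorem PMF.eq_one_of_sum_mul_eq_one {V : Type*} [Fintype V] (μ : PMF V) {f : V → ℝ≥0∞} (hf : ∀ v, f v ≤ 1)
    (h : ∑ v, μ v * f v = 1) {v : V} (hv : 0 < μ v) : f v = 1 := by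
  classical
  by_contra hne
  have hlt : f v < 1 := lt_of_le_of_ne (hf v) hne
  have hsum : ∑ v, μ v = 1 := by rw [← tsum_fintype (L := .unconditional V)]; exact μ.tsum_coe
  have : ∑ v, μ v * f v < ∑ v, μ v := by
    rw [← Finset.add_sum_erase _ _ (Finset.mem_univ v),
      ← Finset.add_sum_erase _ μ (Finset.mem_univ v)]
    have hrest : ∑ w ∈ Finset.univ.erase v, μ w * f w ≤ ∑ w ∈ Finset.univ.erase v, μ w :=
      Finset.sum_le_sum fun w _ => mul_le_of_le_one_right' (hf w)
    refine ENNReal.add_lt_add_of_lt_of_le ?_ ?_ hrest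
    · refine ne_top_of_le_ne_top ENNReal.one_ne_top (hrest.trans ?_)
      rw [← hsum]
      exact Finset.sum_le_sum_of_subset (Finset.erase_subset _ _)
    · calc μ v * f v < μ v * 1 := (ENNReal.mul_lt_mul_iff_right hv.ne' (μ.apply_ne_top v)).2 hlt
        _ = μ v := mul_one _
  rw [h, hsum] at this
  exact lt_irrefl _ this

/-! ### First-step decomposition of the law of the arrivals. -/

section ArrivalLaw

variable {V : Type*} [MeasurableSpace V]

instance arrivalLaw_isProbabilityMeasure (μ : PMF V) : IsProbabilityMeasure (arrivalLaw μ) := by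
  unfold arrivalLaw
  infer_instance

theorem measurable_consSeq (v : V) : Measurable (consSeq v) := by
  refine measurable_pi_iff.2 fun n => ?_
  cases n with
  | zero => exact measurable_const
  | succ n => exact measurable_pi_apply n

variable [Fintype V] [MeasurableSingletonClass V]

/-- The first arrival is independent of the others, which again form an i.i.d. sequence. By
uniqueness of the product measure, it suffices to compare both sides on boxes with finitely many
constraints. -/
theorem sum_smul_map_consSeq (μ : PMF V) :
    ∑ v, μ v • (arrivalLaw μ).map (consSeq v) = arrivalLaw μ := by
  classical
  refine Measure.eq_infinitePi _ fun s t ht => ?_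
  obtain ⟨N, hN⟩ : ∃ N, s ⊆ Finset.range (N + 1) :=
    ⟨s.sup id, fun n hn => Finset.mem_range.2 (Nat.lt_succ_of_le (Finset.le_sup (f := id) hn))⟩
  -- Padding with trivial constraints turns the index set into an initial segment, from which time 0
  -- can be split off.
  set t' : ℕ → Set V := fun n => if n ∈ s then t n else Set.univ with ht'
  have hpi : Set.pi (s : Set ℕ) t = {ω | ∀ n ∈ Finset.range (N + 1), ω n ∈ t' n} := by
    ext ω
    simp only [Set.mem_pi, Set.mem_ofPred_eq, ht']
    constructor
    · intro h n _
      by_cases hn : n ∈ s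
      · simpa [hn] using h n hn
      · simp [hn]
    · intro h n hn
      have hn' : n ∈ s := hn
      simpa [hn'] using h n (hN hn')
  have hmeas : MeasurableSet (Set.pi (s : Set ℕ) t) :=
    MeasurableSet.pi s.countable_toSet fun n _ => ht n
  have hprod : ∏ n ∈ s, μ.toMeasure (t n) = ∏ n ∈ Finset.range (N + 1), μ.toMeasure (t' n) := by
    rw [← Finset.prod_subset hN]
    · exact Finset.prod_congr rfl fun n hn => by simp [ht', hn]
    · intro n _ hn
      simp [ht', hn, -PMF.toMeasure_apply_fintype]
  have hstep : ∀ v, (arrivalLaw μ).map (consSeq v) (Set.pi (s : Set ℕ) t) =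
      (t' 0).indicator 1 v * ∏ n ∈ Finset.range N, μ.toMeasure (t' (n + 1)) := by
    intro v
    rw [Measure.map_apply (measurable_consSeq v) hmeas, hpi]
    have hmem : ∀ ω : ℕ → V, (∀ n ∈ Finset.range (N + 1), consSeq v ω n ∈ t' n) ↔
        v ∈ t' 0 ∧ ∀ n ∈ Finset.range N, ω n ∈ t' (n + 1) := by
      intro ω
      simp only [Finset.mem_range]
      constructor
      · exact fun h => ⟨h 0 (Nat.succ_pos N), fun n hn => h (n + 1) (by omega)⟩
      · rintro ⟨h0, h⟩ n hn
        cases n with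
        | zero => exact h0
        | succ n => exact h n (by omega)
    have hmem' : consSeq v ⁻¹' {ω | ∀ n ∈ Finset.range (N + 1), ω n ∈ t' n} =
        {ω | v ∈ t' 0 ∧ ∀ n ∈ Finset.range N, ω n ∈ t' (n + 1)} := Set.ext hmem
    rw [hmem']
    by_cases hv : v ∈ t' 0
    · have := Measure.infinitePi_pi (fun _ : ℕ => μ.toMeasure) (s := Finset.range N)
        (t := fun n => t' (n + 1)) (fun n _ => (Set.toFinite _).measurableSet)
      simp only [hv, true_and, Set.indicator_of_mem, Pi.one_apply, one_mul]
      exact this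
    · simp [hv]
  rw [hprod, Finset.prod_range_succ', Measure.finsetSum_apply]
  simp only [Measure.smul_apply, hstep, smul_eq_mul]
  rw [mul_comm, PMF.toMeasure_apply_fintype, Finset.sum_mul]
  refine Finset.sum_congr rfl fun v _ => ?_
  by_cases hv : v ∈ t' 0 <;> simp [hv]

theorem arrivalLaw_eq_sum (μ : PMF V) {A : Set (ℕ → V)} (hA : MeasurableSet A) :
    arrivalLaw μ A = ∑ v, μ v * arrivalLaw μ {ω | consSeq v ω ∈ A} := by
  conv_lhs => rw [← sum_smul_map_consSeq μ]
  rw [Measure.finsetSum_apply]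
  refine Finset.sum_congr rfl fun v _ => ?_
  rw [Measure.smul_apply, Measure.map_apply (measurable_consSeq v) hA]
  rfl

end ArrivalLaw

/-! ### Visit probabilities, maximal inequality and transience for a general model. -/

section Chain

variable {V : Type*} [DecidableEq V] {G : SimpleGraph V} (Φ : MatchingPolicy G)

theorem MatchingPolicy.chain_consSeq (u : Buffer G) (v : V) (ω : ℕ → V) (n : ℕ) :
    Φ.chain u (consSeq v ω) (n + 1) = Φ.chain (Φ.next u v) ω n := by
  induction n with
  | zero => rfl
  | succ n ih =>
    change Φ.next (Φ.chain u (consSeq v ω) (n + 1)) (ω n) = _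
    rw [ih]
    rfl

variable [MeasurableSpace V]

/-- The probability that the chain started from `u` visits `S`. -/
noncomputable def MatchingPolicy.visitProb (μ : PMF V) (S : Set (Buffer G)) (u : Buffer G) :
    ℝ≥0∞ :=
  arrivalLaw μ {ω | ∃ n, Φ.chain u ω n ∈ S}

theorem MatchingPolicy.visitProb_le_one (μ : PMF V) (S : Set (Buffer G)) (u : Buffer G) :
    Φ.visitProb μ S u ≤ 1 :=
  prob_le_one

theorem MatchingPolicy.visitProb_of_mem (μ : PMF V) {S : Set (Buffer G)} {u : Buffer G}
    (hu : u ∈ S) : Φ.visitProb μ S u = 1 := by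
  have : {ω : ℕ → V | ∃ n, Φ.chain u ω n ∈ S} = Set.univ :=
    Set.eq_univ_of_forall fun ω => ⟨0, hu⟩
  rw [visitProb, this, measure_univ]

variable [Fintype V] [MeasurableSingletonClass V]

theorem MatchingPolicy.measurableSet_chain_mem (u : Buffer G) (n : ℕ) (S : Set (Buffer G)) :
    MeasurableSet {ω : ℕ → V | Φ.chain u ω n ∈ S} := by
  induction n generalizing S with
  | zero => exact MeasurableSet.const (u ∈ S)
  | succ n ih =>
    have : {ω : ℕ → V | Φ.chain u ω (n + 1) ∈ S} =
        ⋃ v, {ω | Φ.chain u ω n ∈ {w | Φ.next w v ∈ S}} ∩ {ω | ω n = v} := by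
      ext ω
      simp [MatchingPolicy.chain]
    rw [this]
    exact MeasurableSet.iUnion fun v =>
      (ih _).inter ((measurableSet_singleton v).preimage (measurable_pi_apply n))

theorem MatchingPolicy.sum_mul_visitProb_next (μ : PMF V) (S : Set (Buffer G)) (u : Buffer G) :
    arrivalLaw μ {ω | ∃ n, 1 ≤ n ∧ Φ.chain u ω n ∈ S} =
      ∑ v, μ v * Φ.visitProb μ S (Φ.next u v) := by
  have hm : MeasurableSet {ω : ℕ → V | ∃ n, 1 ≤ n ∧ Φ.chain u ω n ∈ S} := by
    simp only [Set.ofPred_exists]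
    exact MeasurableSet.iUnion fun n =>
      (MeasurableSet.const (1 ≤ n)).inter (Φ.measurableSet_chain_mem u n S)
  rw [arrivalLaw_eq_sum μ hm]
  refine Finset.sum_congr rfl fun v _ => ?_
  congr 2
  ext ω
  constructor
  · rintro ⟨n, hn, h⟩
    obtain ⟨m, rfl⟩ := Nat.exists_eq_add_of_le' hn
    exact ⟨m, by rwa [Φ.chain_consSeq] at h⟩
  · rintro ⟨n, h⟩
    exact ⟨n + 1, by omega, by rwa [Φ.chain_consSeq]⟩

theorem MatchingPolicy.visitProb_of_notMem (μ : PMF V) {S : Set (Buffer G)} {u : Buffer G}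
    (hu : u ∉ S) : Φ.visitProb μ S u = ∑ v, μ v * Φ.visitProb μ S (Φ.next u v) := by
  rw [← Φ.sum_mul_visitProb_next, visitProb]
  congr 1
  ext ω
  constructor
  · rintro ⟨n, h⟩
    refine ⟨n, ?_, h⟩
    rcases n with _ | n
    · exact absurd h hu
    · omega
  · rintro ⟨n, _, h⟩
    exact ⟨n, h⟩

/-- A maximal inequality: a function that is superharmonic where it is less than `m` bounds the
probability to visit the set where it is at least `m`. -/
theorem MatchingPolicy.visitProb_le_div (μ : PMF V) (F : Buffer G → ℝ≥0∞) {m : ℝ≥0∞}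
    (hm0 : m ≠ 0) (hm : m ≠ ∞)
    (hF : ∀ u, F u < m → ∑ v, μ v * F (Φ.next u v) ≤ F u) (u : Buffer G) :
    Φ.visitProb μ {w | m ≤ F w} u ≤ F u / m := by
  -- The bound is proved up to a finite horizon by first-step induction, then passed to the limit by
  -- continuity from below.
  have key : ∀ N u, arrivalLaw μ {ω | ∃ n ≤ N, m ≤ F (Φ.chain u ω n)} ≤ F u / m := by
    intro N
    induction N with
    | zero =>
      intro u
      by_cases hu : m ≤ F u
      · exact prob_le_one.trans ((ENNReal.le_div_iff_mul_le (Or.inl hm0) (Or.inl hm)).2 (by rwa [one_mul]))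
      · simp [MatchingPolicy.chain, hu]
    | succ N ih =>
      intro u
      by_cases hu : m ≤ F u
      · exact prob_le_one.trans ((ENNReal.le_div_iff_mul_le (Or.inl hm0) (Or.inl hm)).2 (by rwa [one_mul]))
      · have hmeas : MeasurableSet {ω : ℕ → V | ∃ n ≤ N + 1, m ≤ F (Φ.chain u ω n)} := by
          simp only [Set.ofPred_exists]
          exact MeasurableSet.iUnion fun n =>
            (MeasurableSet.const (n ≤ N + 1)).inter (Φ.measurableSet_chain_mem u n {w | m ≤ F w})
        rw [arrivalLaw_eq_sum μ hmeas]
        calc ∑ v, μ v * arrivalLaw μ {ω | consSeq v ω ∈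
              {ω : ℕ → V | ∃ n ≤ N + 1, m ≤ F (Φ.chain u ω n)}}
            ≤ ∑ v, μ v * (F (Φ.next u v) / m) := by
              gcongr with v
              refine le_trans (measure_mono ?_) (ih (Φ.next u v))
              rintro ω ⟨n, hn, h⟩
              cases n with
              | zero => exact absurd h hu
              | succ n => exact ⟨n, by omega, by rwa [Φ.chain_consSeq] at h⟩
          _ = (∑ v, μ v * F (Φ.next u v)) / m := by
              simp only [div_eq_mul_inv, Finset.sum_mul, mul_assoc]
          _ ≤ F u / m := by gcongr; exact hF u (not_le.1 hu)
  have hU : {ω : ℕ → V | ∃ n, Φ.chain u ω n ∈ {w | m ≤ F w}} =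
      ⋃ N, {ω | ∃ n ≤ N, m ≤ F (Φ.chain u ω n)} := by
    ext ω
    simp only [Set.mem_ofPred_eq, Set.mem_iUnion]
    exact ⟨fun ⟨n, h⟩ => ⟨n, n, le_rfl, h⟩, fun ⟨_, n, _, h⟩ => ⟨n, h⟩⟩
  rw [visitProb, hU, Monotone.measure_iUnion]
  · exact iSup_le fun N => key N u
  · rintro M N hMN ω ⟨n, hn, h⟩
    exact ⟨n, hn.trans hMN, h⟩

/-- A state to which the chain almost surely returns is almost surely visited from every state
that can be reached from it. -/
theorem MatchingPolicy.visitProb_chain_eq_one (μ : PMF V) {u : Buffer G}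
    (h : arrivalLaw μ {ω | ∃ n, 1 ≤ n ∧ Φ.chain u ω n = u} = 1) {ω : ℕ → V}
    (hω : ∀ n, 0 < μ (ω n)) (n : ℕ) : Φ.visitProb μ {u} (Φ.chain u ω n) = 1 := by
  have hsum : ∑ v, μ v * Φ.visitProb μ {u} (Φ.next u v) = 1 := by
    rw [← Φ.sum_mul_visitProb_next]
    exact h
  induction n with
  | zero => exact Φ.visitProb_of_mem μ rfl
  | succ n ih =>
    refine μ.eq_one_of_sum_mul_eq_one
      (f := fun v => Φ.visitProb μ {u} (Φ.next (Φ.chain u ω n) v))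
      (fun v => Φ.visitProb_le_one μ _ _) ?_ (hω n)
    -- A visit at time 0 counts, so the visit probability need not be harmonic at `u` itself; the
    -- almost sure return replaces harmonicity there.
    by_cases hn : Φ.chain u ω n = u
    · rw [hn]
      exact hsum
    · rw [← Φ.visitProb_of_notMem μ (by simpa using hn)]
      exact ih

/-- If it is almost sure not to stay eventually in `S`, then it is so from every state that can be
reached. -/
theorem MatchingPolicy.arrivalLaw_eventually_mem_eq_zero (μ : PMF V) (S : Set (Buffer G))
    {u : Buffer G} (h : arrivalLaw μ {ω | ∃ N, ∀ n, N ≤ n → Φ.chain u ω n ∈ S} = 0)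
    {ω : ℕ → V} (hω : ∀ n, 0 < μ (ω n)) (k : ℕ) :
    arrivalLaw μ {ω' | ∃ N, ∀ n, N ≤ n → Φ.chain (Φ.chain u ω k) ω' n ∈ S} = 0 := by
  induction k with
  | zero => exact h
  | succ k ih =>
    have hm : MeasurableSet {ω' : ℕ → V | ∃ N, ∀ n, N ≤ n →
        Φ.chain (Φ.chain u ω k) ω' n ∈ S} := by
      simp only [Set.ofPred_exists, Set.ofPred_forall]
      exact MeasurableSet.iUnion fun N => MeasurableSet.iInter fun n =>
        MeasurableSet.iInter fun _ => Φ.measurableSet_chain_mem _ n S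
    rw [arrivalLaw_eq_sum μ hm, Finset.sum_eq_zero_iff] at ih
    have h0 := (mul_eq_zero.1 (ih (ω k) (Finset.mem_univ _))).resolve_left (hω k).ne'
    refine measure_mono_null ?_ h0
    rintro ω' ⟨N, hN⟩
    refine ⟨N + 1, fun n hn => ?_⟩
    obtain ⟨n, rfl⟩ := Nat.exists_eq_add_of_le' (by omega : 1 ≤ n)
    rw [Φ.chain_consSeq]
    exact hN n (by omega)

/-- A transient model is unstable. -/
theorem MatchingPolicy.Transient.not_stable {μ : PMF V} (h : Φ.Transient μ) : ¬ Φ.Stable μ := by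
  intro hs
  let u := Buffer.empty G
  set A : Set (ℕ → V) := {ω | ∃ n, 1 ≤ n ∧ Φ.chain u ω n = u} with hA
  have hmA : MeasurableSet A := by
    simp only [hA, Set.ofPred_exists]
    exact MeasurableSet.iUnion fun n =>
      (MeasurableSet.const (1 ≤ n)).inter (Φ.measurableSet_chain_mem u n {u})
  have hpos : arrivalLaw μ Aᶜ ≠ 0 := fun h0 =>
    (h u).ne ((prob_compl_eq_zero_iff hmA).1 h0)
  -- Without a return the infimum defining `returnTime` is over no admissible time, hence infinite.
  have hle : ∞ * arrivalLaw μ Aᶜ ≤ ∫⁻ ω, Φ.returnTime u ω ∂(arrivalLaw μ) := by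
    rw [← lintegral_indicator_const hmA.compl]
    refine lintegral_mono fun ω => ?_
    by_cases hω : ω ∈ A
    · simp [hω]
    · refine le_of_le_of_eq le_top ?_
      rw [returnTime]
      symm
      simp only [iInf_eq_top]
      exact fun n hn => absurd ⟨n, hn⟩ hω
  rw [ENNReal.top_mul hpos] at hle
  exact (hs u).not_ge hle

end Chain

/-! ### Effect of one arrival on the class counts. -/

section Counts

variable {V : Type*} [DecidableEq V] {G : SimpleGraph V} {Φ : MatchingPolicy G}

theorem Buffer.notMem_of_adj (u : Buffer G) {i j : V} (h : G.Adj i j) (hi : i ∈ u.1) :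
    j ∉ u.1 := by
  intro hj
  have := Nat.mul_pos (List.count_pos_iff.2 hi) (List.count_pos_iff.2 hj)
  exact this.ne' (u.2 i j h)

theorem MatchingPolicy.count_next_of_unmatched {u : Buffer G} {v : V}
    (h : ∀ j ∈ u.1, ¬ G.Adj v j) (i : V) :
    (Φ.next u v).1.count i = u.1.count i + if i = v then 1 else 0 := by
  rw [Φ.next_of_unmatched u v h, List.count_append, List.count_singleton]
  simp only [beq_iff_eq, @eq_comm _ i v]

theorem MatchingPolicy.IsPriority.count_next {pref : Preferences G} (hΦ : Φ.IsPriority pref)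
    {u : Buffer G} {v j : V} (hj : j ∈ u.1) (hv : G.Adj v j)
    (hmax : ∀ k ∈ u.1, G.Adj v k → k = j ∨ pref.lt v k j) (i : V) :
    (Φ.next u v).1.count i + (if i = j then 1 else 0) = u.1.count i := by
  have h := congrArg (Multiset.count i) (hΦ u v j hj hv hmax)
  rw [Multiset.coe_count] at h
  rw [h]
  by_cases hij : i = j
  · subst hij
    have := List.count_pos_iff.2 hj
    rw [Multiset.count_erase_self, Multiset.coe_count, if_pos rfl]
    omega
  · rw [Multiset.count_erase_of_ne hij, Multiset.coe_count, if_neg hij, add_zero]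

/-! ### Existence of a priority policy with the required preferences. -/

/-- The preferences of every class for the greatest classes. -/
def maxPreferences {n : ℕ} (G : SimpleGraph (Fin n)) : Preferences G where
  lt _ j k := j < k
  strictTotal i := inferInstanceAs (IsStrictTotalOrder (G.neighborSet i) (· < ·))

theorem Buffer.exists_max_adj {n : ℕ} {G : SimpleGraph (Fin n)} (u : Buffer G) (v : Fin n)
    (h : ∃ j ∈ u.1, G.Adj v j) : ∃ j ∈ u.1, G.Adj v j ∧ ∀ k ∈ u.1, G.Adj v k → k ≤ j := by
  classical
  obtain ⟨i, hi, hiv⟩ := h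
  obtain ⟨j, hj, hmax⟩ := (u.1.toFinset.filter (G.Adj v)).exists_max_image id
    ⟨i, by simp [hi, hiv]⟩
  simp only [Finset.mem_filter, List.mem_toFinset, id] at hj hmax
  exact ⟨j, hj.1, hj.2, fun k hk hvk => hmax k ⟨hk, hvk⟩⟩

/-- The buffer from which an item of class `j` has been removed. -/
def Buffer.erase (u : Buffer G) (j : V) : Buffer G :=
  ⟨u.1.erase j, fun i k hik => Nat.eq_zero_of_le_zero <|
    (Nat.mul_le_mul (List.erase_sublist.count_le i) (List.erase_sublist.count_le k)).trans
      (u.2 i k hik).le⟩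

/-- The buffer to which an item with no compatible item has been added. -/
def Buffer.append (u : Buffer G) (v : V) (h : ∀ j ∈ u.1, ¬ G.Adj v j) : Buffer G :=
  ⟨u.1 ++ [v], fun i j hij => by
    have hi : i = v → u.1.count j = 0 := fun hi =>
      List.count_eq_zero.2 fun hj => h j hj (hi ▸ hij)
    have hj : j = v → u.1.count i = 0 := fun hj =>
      List.count_eq_zero.2 fun hi => h i hi (hj ▸ hij.symm)
    have hne := hij.ne
    have := u.2 i j hij
    simp only [List.count_append, List.count_singleton, beq_iff_eq]
    by_cases h1 : v = i
    · have h2 : v ≠ j := fun h2 => hne (h1.symm.trans h2)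
      simp [h2, hi h1.symm]
    · by_cases h2 : v = j
      · simp [h1, hj h2.symm]
      · simpa [h1, h2] using this⟩

open Classical in
/-- The policy that removes an item of the greatest compatible class. -/
noncomputable def maxPolicy {n : ℕ} (G : SimpleGraph (Fin n)) : MatchingPolicy G where
  next u v :=
    if h : ∃ j ∈ u.1, G.Adj v j then u.erase (u.exists_max_adj v h).choose
    else u.append v fun j hj hv => h ⟨j, hj, hv⟩
  next_of_unmatched u v h := by
    have h' : ¬ ∃ j ∈ u.1, G.Adj v j := fun ⟨j, hj, hv⟩ => h j hj hv
    rw [dif_neg h']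
    rfl
  next_of_matched u v h := by
    rw [dif_pos h]
    have hs := (u.exists_max_adj v h).choose_spec
    obtain ⟨l, r, -, h1, h2⟩ := List.exists_erase_eq hs.1
    exact ⟨l, _, r, h1, hs.2.1, h2⟩

theorem maxPolicy_isPriority {n : ℕ} (G : SimpleGraph (Fin n)) :
    (maxPolicy G).IsPriority (maxPreferences G) := by
  intro u v j hj hv hmax
  have h : ∃ j ∈ u.1, G.Adj v j := ⟨j, hj, hv⟩
  have hs := (u.exists_max_adj v h).choose_spec
  have hle : (u.exists_max_adj v h).choose ≤ j :=
    (hmax _ hs.1 hs.2.1).elim (fun h => h.le) fun h => le_of_lt h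
  have heq : (u.exists_max_adj v h).choose = j := le_antisymm hle (hs.2.2 j hj hv)
  simp only [maxPolicy]
  rw [dif_pos h, heq, Multiset.coe_erase]
  rfl

end Counts

/-! ### Dynamics on the 5-cycle while class 1 is present. -/

section FiveCycle

theorem Buffer.mem_of_zero_mem {u : Buffer fiveCycle} (h0 : 0 ∈ u.1) :
    ∀ i ∈ u.1, i = 0 ∨ i = 2 ∨ i = 3 := by
  have h1 : (1 : Fin 5) ∉ u.1 := u.notMem_of_adj (by decide) h0
  have h4 : (4 : Fin 5) ∉ u.1 := u.notMem_of_adj (by decide) h0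
  intro i hi
  fin_cases i <;> simp_all

/-- The jumps of the position at the arrival of each class, from a buffer that contains the
class 1 only. -/
def axisJump : Fin 5 → ℤ × ℤ := ![(1, 0), (-1, 0), (0, 1), (0, 1), (-1, 0)]

/-- The jumps of the position at the arrival of each class, from a buffer that contains the
classes 1 and 3. -/
def leftJump : Fin 5 → ℤ × ℤ := ![(1, 0), (0, -1), (0, 1), (0, -1), (-1, 0)]

/-- The jumps of the position at the arrival of each class, from a buffer that contains the
classes 1 and 4. -/
def rightJump : Fin 5 → ℤ × ℤ := ![(1, 0), (-1, 0), (0, -1), (0, 1), (0, -1)]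

variable {pref : Preferences fiveCycle} {Φ : MatchingPolicy fiveCycle}

theorem quarterPosition_next_of_unmatched {u : Buffer fiveCycle} {v : Fin 5}
    (h : ∀ j ∈ u.1, ¬ fiveCycle.Adj v j) :
    quarterPosition (Φ.next u v) = quarterPosition u +
      ((if 0 = v then 1 else 0), (if 2 = v then 1 else 0) + (if 3 = v then 1 else 0)) := by
  simp only [quarterPosition, MatchingPolicy.count_next_of_unmatched h]
  ext <;> push_cast <;> simp
  ring

theorem quarterPosition_next_of_matched (hΦ : Φ.IsPriority pref) {u : Buffer fiveCycle}
    {v j : Fin 5} (hj : j ∈ u.1) (hv : fiveCycle.Adj v j)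
    (hmax : ∀ k ∈ u.1, fiveCycle.Adj v k → k = j ∨ pref.lt v k j) :
    quarterPosition (Φ.next u v) = quarterPosition u -
      ((if 0 = j then 1 else 0), (if 2 = j then 1 else 0) + (if 3 = j then 1 else 0)) := by
  simp only [quarterPosition, ← hΦ.count_next hj hv hmax]
  ext <;> push_cast <;> simp
  ring

/-- Classes 3 and 4 are adjacent, so at most one of them accompanies class 1, which gives three
cases. With class 1 present, only classes 2 and 5 can face a choice, and `h1`, `h4` settle it; this
is why the other preferences play no role. -/
theorem quarterPosition_next (h1 : pref.lt 1 0 2) (h4 : pref.lt 4 0 3) (hΦ : Φ.IsPriority pref)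
    {u : Buffer fiveCycle} (h0 : 0 ∈ u.1) :
    ∃ d : Fin 5 → ℤ × ℤ,
      (∀ v, quarterPosition (Φ.next u v) = quarterPosition u + d v) ∧
      (((quarterPosition u).2 = 0 ∧ d = axisJump) ∨
        (0 < (quarterPosition u).2 ∧ (d = leftJump ∨ d = rightJump))) := by
  have hn1 : (1 : Fin 5) ∉ u.1 := u.notMem_of_adj (by decide) h0
  have hn4 : (4 : Fin 5) ∉ u.1 := u.notMem_of_adj (by decide) h0
  have hadj : ∀ i j : Fin 5, fiveCycle.Adj i j → j = i + 1 ∨ j = i + 4 := by decide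
  have unmatched : ∀ v : Fin 5, v + 1 ∉ u.1 → v + 4 ∉ u.1 → quarterPosition (Φ.next u v) =
      quarterPosition u +
        ((if 0 = v then 1 else 0), (if 2 = v then 1 else 0) + (if 3 = v then 1 else 0)) := by
    intro v hv hv'
    refine quarterPosition_next_of_unmatched fun j hj hvj => ?_
    rcases hadj v j hvj with rfl | rfl
    · exact hv hj
    · exact hv' hj
  -- Here `k` is the other neighbour of `v`; in most uses it is absent and the preference condition
  -- is vacuous.
  have matched : ∀ v j k : Fin 5, j ∈ u.1 → fiveCycle.Adj v j →
      (∀ i, fiveCycle.Adj v i → i = j ∨ i = k) → (k ∈ u.1 → pref.lt v k j) →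
      quarterPosition (Φ.next u v) = quarterPosition u -
        ((if 0 = j then 1 else 0), (if 2 = j then 1 else 0) + (if 3 = j then 1 else 0)) := by
    intro v j k hj hv hk hlt
    refine quarterPosition_next_of_matched hΦ hj hv fun i hi hvi => ?_
    rcases hk i hvi with rfl | rfl
    · exact Or.inl rfl
    · exact Or.inr (hlt hi)
  by_cases h2 : (2 : Fin 5) ∈ u.1
  · have hn3 : (3 : Fin 5) ∉ u.1 := u.notMem_of_adj (by decide) h2
    have hy : 0 < (quarterPosition u).2 := by
      have := List.count_pos_iff.2 h2
      simp only [quarterPosition]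
      omega
    refine ⟨leftJump, fun v => ?_, Or.inr ⟨hy, Or.inl rfl⟩⟩
    fin_cases v
    · exact unmatched 0 hn1 hn4
    · exact matched 1 2 0 h2 (by decide) (by decide) fun _ => h1
    · exact unmatched 2 hn3 hn1
    · exact matched 3 2 4 h2 (by decide) (by decide) fun h => absurd h hn4
    · exact matched 4 0 3 h0 (by decide) (by decide) fun h => absurd h hn3
  by_cases h3 : (3 : Fin 5) ∈ u.1
  · have hy : 0 < (quarterPosition u).2 := by
      have := List.count_pos_iff.2 h3
      simp only [quarterPosition]
      omega
    refine ⟨rightJump, fun v => ?_, Or.inr ⟨hy, Or.inr rfl⟩⟩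
    fin_cases v
    · exact unmatched 0 hn1 hn4
    · exact matched 1 0 2 h0 (by decide) (by decide) fun h => absurd h h2
    · exact matched 2 3 1 h3 (by decide) (by decide) fun h => absurd h hn1
    · exact unmatched 3 hn4 h2
    · exact matched 4 3 0 h3 (by decide) (by decide) fun _ => h4
  · have hy : (quarterPosition u).2 = 0 := by
      simp [quarterPosition, List.count_eq_zero.2 h2, List.count_eq_zero.2 h3]
    refine ⟨axisJump, fun v => ?_, Or.inl ⟨hy, rfl⟩⟩
    fin_cases v
    · exact unmatched 0 hn1 hn4
    · exact matched 1 0 2 h0 (by decide) (by decide) fun h => absurd h h2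
    · exact unmatched 2 h3 hn1
    · exact unmatched 3 hn4 h2
    · exact matched 4 0 3 h0 (by decide) (by decide) fun h => absurd h h3

/-- The number of items of class 1 in excess over the items of the classes 2 and 5 increases at
each arrival of an item of class 1. -/
theorem MatchingPolicy.le_count_zero_chain_const (Φ : MatchingPolicy fiveCycle)
    (u : Buffer fiveCycle) (n : ℕ) :
    n ≤ (Φ.chain u (fun _ => 0) n).1.count 0 + u.1.count 1 + u.1.count 4 := by
  suffices h : n + (Φ.chain u (fun _ => 0) n).1.count 1 + (Φ.chain u (fun _ => 0) n).1.count 4 ≤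
      (Φ.chain u (fun _ => 0) n).1.count 0 + u.1.count 1 + u.1.count 4 by omega
  induction n with
  | zero => simp [MatchingPolicy.chain]
  | succ n ih =>
    simp only [MatchingPolicy.chain]
    set w := Φ.chain u (fun _ => 0) n
    by_cases h : ∃ j ∈ w.1, fiveCycle.Adj 0 j
    · obtain ⟨l, j, r, hw, hj, hr⟩ := Φ.next_of_matched w 0 h
      rw [hw] at ih
      rw [hr]
      have hj' : j = 1 ∨ j = 4 :=
        (by decide : ∀ j : Fin 5, fiveCycle.Adj 0 j → j = 1 ∨ j = 4) j hj
      rcases hj' with rfl | rfl <;> simp [List.count_append] at ih ⊢ <;> omega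
    · have h' : ∀ j ∈ w.1, ¬ fiveCycle.Adj 0 j := fun j hj hv => h ⟨j, hj, hv⟩
      simp only [Φ.count_next_of_unmatched h']
      simp
      omega

end FiveCycle

/-! ### The arrival measure and the choice of the Lyapunov parameters. -/

section Parameters

variable {ε : ℝ}

theorem fiveCycleMass_pos (h0 : 0 < ε) (h1 : ε < 2 / 9) (i : Fin 5) : 0 < fiveCycleMass ε i := by
  fin_cases i <;> simp [fiveCycleMass] <;> linarith

/-- The probability measure of masses `fiveCycleMass ε`. -/
noncomputable def fiveCyclePMF (h0 : 0 < ε) (h1 : ε < 2 / 9) : PMF (Fin 5) :=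
  PMF.ofFintype (fun i => ENNReal.ofReal (fiveCycleMass ε i)) <| by
    rw [← ENNReal.ofReal_sum_of_nonneg fun i _ => (fiveCycleMass_pos h0 h1 i).le,
      ENNReal.ofReal_eq_one]
    simp [fiveCycleMass, Fin.sum_univ_five]
    ring

theorem fiveCyclePMF_apply (h0 : 0 < ε) (h1 : ε < 2 / 9) (i : Fin 5) :
    fiveCyclePMF h0 h1 i = ENNReal.ofReal (fiveCycleMass ε i) :=
  rfl

theorem fiveCyclePMF_pos (h0 : 0 < ε) (h1 : ε < 2 / 9) (i : Fin 5) : 0 < fiveCyclePMF h0 h1 i :=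
  ENNReal.ofReal_pos.2 (fiveCycleMass_pos h0 h1 i)

open Classical in
theorem toMeasure_fiveCyclePMF (h0 : 0 < ε) (h1 : ε < 2 / 9) (F : Set (Fin 5)) :
    (fiveCyclePMF h0 h1).toMeasure F =
      ENNReal.ofReal (∑ i, if i ∈ F then fiveCycleMass ε i else 0) := by
  rw [PMF.toMeasure_apply_fintype, ENNReal.ofReal_sum_of_nonneg]
  · refine Finset.sum_congr rfl fun i _ => ?_
    by_cases hi : i ∈ F <;> simp [hi, fiveCyclePMF_apply]
  · intro i _
    split_ifs
    exacts [(fiveCycleMass_pos h0 h1 i).le, le_rfl]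

theorem fiveCyclePMF_mem_Ncond (h0 : 0 < ε) (h1 : ε < 2 / 9) :
    fiveCyclePMF h0 h1 ∈ Ncond fiveCycle := by
  classical
  refine ⟨fiveCyclePMF_pos h0 h1, fun F hne hF => ?_⟩
  have hind : ∀ i j, i ∈ F → fiveCycle.Adj i j → j ∉ F := fun i j hi hij hj =>
    hF hi hj hij.ne hij
  have hmem : ∀ v, v ∈ {v | ∃ u ∈ F, fiveCycle.Adj u v} ↔ v + 1 ∈ F ∨ v + 4 ∈ F := by
    have hadj : ∀ i j : Fin 5, fiveCycle.Adj i j ↔ i = j + 1 ∨ i = j + 4 := by decide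
    intro v
    simp only [Set.mem_ofPred_eq, hadj]
    constructor
    · rintro ⟨u, hu, rfl | rfl⟩
      exacts [Or.inl hu, Or.inr hu]
    · rintro (h | h)
      exacts [⟨_, h, Or.inl rfl⟩, ⟨_, h, Or.inr rfl⟩]
  have h01 := hind 0 1
  have h12 := hind 1 2
  have h23 := hind 2 3
  have h34 := hind 3 4
  have h40 := hind 4 0
  have hne' : 0 ∈ F ∨ 1 ∈ F ∨ 2 ∈ F ∨ 3 ∈ F ∨ 4 ∈ F := by
    obtain ⟨i, hi⟩ := hne
    fin_cases i <;> simp_all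
  have key : (∑ i, if i ∈ F then fiveCycleMass ε i else 0) <
      ∑ i, if i + 1 ∈ F ∨ i + 4 ∈ F then fiveCycleMass ε i else 0 := by
    have e : ((1 : Fin 5) + 1 = 2 ∧ (2 : Fin 5) + 1 = 3 ∧ (3 : Fin 5) + 1 = 4 ∧
      (4 : Fin 5) + 1 = 0) ∧ ((1 : Fin 5) + 4 = 0 ∧ (2 : Fin 5) + 4 = 1 ∧ (3 : Fin 5) + 4 = 2 ∧
      (4 : Fin 5) + 4 = 3) := by decide
    simp only [Fin.sum_univ_five, e, zero_add]
    have a01 : fiveCycle.Adj 0 1 := by decide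
    have a12 : fiveCycle.Adj 1 2 := by decide
    have a23 : fiveCycle.Adj 2 3 := by decide
    have a34 : fiveCycle.Adj 3 4 := by decide
    have a40 : fiveCycle.Adj 4 0 := by decide
    by_cases m0 : (0 : Fin 5) ∈ F <;> by_cases m1 : (1 : Fin 5) ∈ F <;>
      by_cases m2 : (2 : Fin 5) ∈ F <;> by_cases m3 : (3 : Fin 5) ∈ F <;>
      by_cases m4 : (4 : Fin 5) ∈ F <;>
      first
      | exact absurd m1 (h01 m0 a01)
      | exact absurd m2 (h12 m1 a12)
      | exact absurd m3 (h23 m2 a23)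
      | exact absurd m4 (h34 m3 a34)
      | exact absurd m0 (h40 m4 a40)
      | (simp [m0, m1, m2, m3, m4] at hne'; done)
      | (simp [m0, m1, m2, m3, m4, fiveCycleMass]; linarith)
  rw [toMeasure_fiveCyclePMF, toMeasure_fiveCyclePMF]
  simp only [hmem]
  refine (ENNReal.ofReal_lt_ofReal_iff (lt_of_le_of_lt ?_ key)).2 key
  refine Finset.sum_nonneg fun i _ => ?_
  split_ifs
  exacts [(fiveCycleMass_pos h0 h1 i).le, le_rfl]

/-- Parameters for which the Lyapunov function `s ^ x * (1 + κ * r ^ y)` is superharmonic for the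
quarter-plane walk: on the axis, and in the interior with `z = r ^ (y - 1)`. -/
structure IsLyapunov (ε s κ r : ℝ) : Prop where
  s_pos : 0 < s
  s_lt_one : s < 1
  κ_pos : 0 < κ
  r_pos : 0 < r
  r_lt_one : r < 1
  axis : (1 / 2 - 3 * ε / 4) * (s * (1 + κ)) + (1 / 2 - ε / 4) * (s⁻¹ * (1 + κ)) +
    ε * (1 + κ * r) ≤ 1 + κ
  interior : ∀ z, 0 ≤ z → z ≤ 1 →
    (1 / 2 - 3 * ε / 4) * (s * (1 + κ * (r * z))) +
      (1 / 4 - ε / 8) * (s⁻¹ * (1 + κ * (r * z))) + ε / 2 * (1 + κ * (r * (r * z))) +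
      (1 / 4 + 3 * ε / 8) * (1 + κ * z) ≤ 1 + κ * (r * z)

/-- With `s = 1 - t`, `κ = t * k` and `r = 1 - η`, the function is `1 - t * (x - k * r ^ y)` to
first order in `t`. It thus suffices that `x - k * r ^ y` has drift bounded below by a positive
constant, and then to take `t` small. -/
theorem exists_isLyapunov (h0 : 0 < ε) (h1 : ε < 2 / 9) : ∃ s κ r : ℝ, IsLyapunov ε s κ r := by
  -- With `c = k * η`, the axis drift of `x - k * r ^ y` is `ε * (c - 1/2)`, whence the lower bound;
  -- the upper one makes the interior drift positive for small `η`. The interval is nonempty because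
  -- `ε < 2/9`.
  obtain ⟨c, hc, hc'⟩ : ∃ c : ℝ, 1 / 2 < c ∧ c < (2 - 5 * ε) / (2 - ε) := by
    refine exists_between ?_
    rw [lt_div_iff₀ (by linarith)]
    linarith
  rw [lt_div_iff₀ (by linarith)] at hc'
  have hc1 : c < 1 := by nlinarith
  -- This `η` is the interior slack before the second-order term, so the remaining slack is `η * (1
  -- - c * ε / 2)`.
  set η : ℝ := (2 - 5 * ε - c * (2 - ε)) / 8 with hη
  have hη0 : 0 < η := by rw [hη]; linarith
  have hη1 : η < 1 := by rw [hη]; nlinarith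
  have hslack : (1 / 4 - 5 * ε / 8) - c * (1 / 4 - ε / 8 + ε / 2 * η) > 0 := by
    have hcε : c * ε < 1 := mul_lt_one_of_nonneg_of_lt_one_left (by linarith) hc1 (by linarith)
    have := mul_pos hη0 (by linarith : 0 < 1 - c * ε / 2)
    linear_combination this + hη
  set k : ℝ := c / η with hk
  have hkη : k * η = c := div_mul_cancel₀ _ hη0.ne'
  have hk0 : 0 < k := div_pos (by linarith) hη0
  -- The two expressions are the increments of the mean divided by `t`, the interior one in its
  -- worst case; both are negative at `t = 0`.
  have hev1 : ∀ᶠ t in nhdsWithin (0 : ℝ) (Set.Ioi 0),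
      (-(1 / 2 - 3 * ε / 4) + (1 / 2 - ε / 4) * (1 - t)⁻¹) * (1 + t * k) - ε * c < 0 := by
    have hcont : ContinuousAt (fun t : ℝ =>
        (-(1 / 2 - 3 * ε / 4) + (1 / 2 - ε / 4) * (1 - t)⁻¹) * (1 + t * k) - ε * c) 0 := by
      fun_prop (disch := norm_num)
    refine (hcont.eventually_lt_const ?_).filter_mono nhdsWithin_le_nhds
    norm_num
    nlinarith
  have hev2 : ∀ᶠ t in nhdsWithin (0 : ℝ) (Set.Ioi 0),
      -(1 / 2 - 3 * ε / 4) + (1 / 4 - ε / 8) * (1 - t)⁻¹ +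
        c * (1 / 4 - ε / 8 + ε / 2 * η) < 0 := by
    have hcont : ContinuousAt (fun t : ℝ => -(1 / 2 - 3 * ε / 4) + (1 / 4 - ε / 8) * (1 - t)⁻¹ +
        c * (1 / 4 - ε / 8 + ε / 2 * η)) 0 := by
      fun_prop (disch := norm_num)
    refine (hcont.eventually_lt_const ?_).filter_mono nhdsWithin_le_nhds
    norm_num
    linarith
  have hev3 : ∀ᶠ t in nhdsWithin (0 : ℝ) (Set.Ioi 0), t < 1 :=
    (eventually_lt_nhds one_pos).filter_mono nhdsWithin_le_nhds
  obtain ⟨t, ⟨⟨ht1, ht2⟩, ht3⟩, ht0⟩ :=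
    (((hev1.and hev2).and hev3).and self_mem_nhdsWithin).exists
  have ht0 : 0 < t := ht0
  have hinv : (1 - t)⁻¹ = 1 + t * (1 - t)⁻¹ := by
    have : (1 - t) ≠ 0 := by linarith
    field_simp
    ring
  set w := (1 - t)⁻¹ with hw
  have hw0 : 0 < w := inv_pos.2 (by linarith)
  refine ⟨1 - t, t * k, 1 - η, by linarith, by linarith, by positivity, by linarith, by linarith,
    ?_, fun z hz0 hz1 => ?_⟩
  · have : (1 / 2 - 3 * ε / 4) * ((1 - t) * (1 + t * k)) + (1 / 2 - ε / 4) * (w * (1 + t * k)) +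
        ε * (1 + t * k * (1 - η)) - (1 + t * k) =
        t * ((-(1 / 2 - 3 * ε / 4) + (1 / 2 - ε / 4) * w) * (1 + t * k) - ε * c) := by
      rw [← hkη]
      linear_combination (1 / 2 - ε / 4) * (1 + t * k) * hinv
    have := mul_neg_of_pos_of_neg ht0 ht1
    linarith
  · have hA : -(1 / 2 - 3 * ε / 4) + (1 / 4 - ε / 8) * w ≤ 0 := by
      have : 0 ≤ c * (1 / 4 - ε / 8 + ε / 2 * η) := by
        have : 0 ≤ ε / 2 * η := by positivity
        exact mul_nonneg (by linarith) (by linarith)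
      linarith
    have hid : (1 / 2 - 3 * ε / 4) * ((1 - t) * (1 + t * k * ((1 - η) * z))) +
        (1 / 4 - ε / 8) * (w * (1 + t * k * ((1 - η) * z))) +
        ε / 2 * (1 + t * k * ((1 - η) * ((1 - η) * z))) +
        (1 / 4 + 3 * ε / 8) * (1 + t * k * z) - (1 + t * k * ((1 - η) * z)) =
        t * ((-(1 / 2 - 3 * ε / 4) + (1 / 4 - ε / 8) * w) * (1 + t * k * ((1 - η) * z)) +
          c * (1 / 4 - ε / 8 + ε / 2 * η) * z) := by
      rw [← hkη]
      linear_combination (1 / 4 - ε / 8) * (1 + t * k * ((1 - η) * z)) * hinv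
    have hone : 1 ≤ 1 + t * k * ((1 - η) * z) := by
      have : 0 ≤ t * k * ((1 - η) * z) :=
        mul_nonneg (by positivity) (mul_nonneg (by linarith) hz0)
      linarith
    have hB : 0 ≤ c * (1 / 4 - ε / 8 + ε / 2 * η) :=  by
      have : 0 ≤ ε / 2 * η := by positivity
      exact mul_nonneg (by linarith) (by linarith)
    -- The coefficient is nonpositive, so the factor at least 1 can be dropped; the other term is
    -- largest at `z = 1`.
    have h3 : (-(1 / 2 - 3 * ε / 4) + (1 / 4 - ε / 8) * w) * (1 + t * k * ((1 - η) * z)) ≤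
        (-(1 / 2 - 3 * ε / 4) + (1 / 4 - ε / 8) * w) * 1 :=
      mul_le_mul_of_nonpos_left hone hA
    have h4 : c * (1 / 4 - ε / 8 + ε / 2 * η) * z ≤ c * (1 / 4 - ε / 8 + ε / 2 * η) :=
      mul_le_of_le_one_right hB hz1
    have h5 : t * ((-(1 / 2 - 3 * ε / 4) + (1 / 4 - ε / 8) * w) * (1 + t * k * ((1 - η) * z)) +
          c * (1 / 4 - ε / 8 + ε / 2 * η) * z) ≤ 0 :=
      mul_nonpos_of_nonneg_of_nonpos ht0.le (by linarith)
    linarith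

end Parameters

/-! ### Superharmonicity and its consequences. -/

section Lyapunov

/-- The Lyapunov function on the quarter plane. -/
noncomputable def lyapunov (s κ r : ℝ) (p : ℤ × ℤ) : ℝ :=
  s ^ p.1 * (1 + κ * r ^ p.2)

theorem lyapunov_pos {s κ r : ℝ} (hs : 0 < s) (hκ : 0 < κ) (hr : 0 < r) (p : ℤ × ℤ) :
    0 < lyapunov s κ r p := by
  unfold lyapunov
  positivity

theorem lyapunov_add {s κ r : ℝ} (hs : 0 < s) (hr : 0 < r) (p d : ℤ × ℤ) :
    lyapunov s κ r (p + d) = s ^ p.1 * (s ^ d.1 * (1 + κ * (r ^ p.2 * r ^ d.2))) := by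
  simp only [lyapunov, Prod.fst_add, Prod.snd_add, zpow_add₀ hs.ne', zpow_add₀ hr.ne', mul_assoc]

variable {ε s κ r : ℝ} {pref : Preferences fiveCycle} {Φ : MatchingPolicy fiveCycle}

theorem IsLyapunov.sum_le (h : IsLyapunov ε s κ r) (h1 : pref.lt 1 0 2) (h4 : pref.lt 4 0 3)
    (hΦ : Φ.IsPriority pref) {u : Buffer fiveCycle} (h0 : 0 ∈ u.1) :
    ∑ v, fiveCycleMass ε v * lyapunov s κ r (quarterPosition (Φ.next u v)) ≤
      lyapunov s κ r (quarterPosition u) := by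
  obtain ⟨d, hd, hd'⟩ := quarterPosition_next h1 h4 hΦ h0
  simp only [hd, lyapunov_add h.s_pos h.r_pos]
  set p := quarterPosition u
  have hsp : 0 < s ^ p.1 := zpow_pos h.s_pos _
  unfold lyapunov
  simp only [mul_left_comm _ (s ^ p.1), ← Finset.mul_sum]
  refine mul_le_mul_of_nonneg_left ?_ hsp.le
  rcases hd' with ⟨hy, rfl⟩ | ⟨hy, hd'⟩
  · have := h.axis
    simp [hy, Fin.sum_univ_five, axisJump, fiveCycleMass]
    linarith
  · have hz : r ^ p.2 = r * r ^ (p.2 - 1) := by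
      rw [← zpow_one_add₀ h.r_pos.ne']
      congr 1
      ring
    obtain ⟨n, hn⟩ := Int.eq_ofNat_of_zero_le (by omega : 0 ≤ p.2 - 1)
    have hz0 : 0 ≤ r ^ (p.2 - 1) := (zpow_pos h.r_pos _).le
    have hz1 : r ^ (p.2 - 1) ≤ 1 := by
      rw [hn, zpow_natCast]
      exact pow_le_one₀ h.r_pos.le h.r_lt_one.le
    have := h.interior _ hz0 hz1
    rw [hz]
    set z := r ^ (p.2 - 1)
    have hzr : r * z * r⁻¹ = z := by
      rw [mul_comm r z]
      exact mul_inv_cancel_right₀ h.r_pos.ne' z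
    -- The masses are symmetric under exchanging 2 with 5 and 3 with 4, so both sides give the same
    -- inequality.
    rcases hd' with rfl | rfl
    all_goals
      simp [Fin.sum_univ_five, leftJump, rightJump, fiveCycleMass, hzr]
      linarith

theorem IsLyapunov.one_le (h : IsLyapunov ε s κ r) {u : Buffer fiveCycle} (h0 : 0 ∉ u.1) :
    1 ≤ lyapunov s κ r (quarterPosition u) := by
  have hr := h.r_pos
  have hκ := h.κ_pos
  have : 0 ≤ κ * r ^ (quarterPosition u).2 := by positivity
  have hx : (quarterPosition u).1 = 0 := by simp [quarterPosition, List.count_eq_zero.2 h0]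
  rw [lyapunov, hx]
  simpa using this

theorem IsLyapunov.le_pow (h : IsLyapunov ε s κ r) {u : Buffer fiveCycle} {n : ℕ}
    (hn : n ≤ u.1.count 0) : lyapunov s κ r (quarterPosition u) ≤ s ^ n * (1 + κ) := by
  have hr := h.r_pos
  have hs := h.s_pos
  have hκ := h.κ_pos
  have hy : r ^ (quarterPosition u).2 ≤ 1 := by
    have : (quarterPosition u).2 = ((u.1.count 2 + u.1.count 3 : ℕ) : ℤ) := by
      simp [quarterPosition]
    rw [this, zpow_natCast]
    exact pow_le_one₀ hr.le h.r_lt_one.le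
  have hx : s ^ (quarterPosition u).1 ≤ s ^ n := by
    simp only [quarterPosition, zpow_natCast]
    exact pow_le_pow_of_le_one hs.le h.s_lt_one.le hn
  unfold lyapunov
  gcongr
  nlinarith

/-- After sufficiently many arrivals of items of class 1, the Lyapunov function is small. -/
theorem IsLyapunov.exists_lt (h : IsLyapunov ε s κ r) (Φ : MatchingPolicy fiveCycle)
    (u : Buffer fiveCycle) {m : ℝ} (hm : 0 < m) :
    ∃ n, lyapunov s κ r (quarterPosition (Φ.chain u (fun _ => 0) n)) < m := by
  have hκ := h.κ_pos
  obtain ⟨n, hn⟩ := exists_pow_lt_of_lt_one (div_pos hm (by linarith : 0 < 1 + κ)) h.s_lt_one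
  rw [lt_div_iff₀ (by linarith)] at hn
  -- The extra arrivals make up for those matched with the initial items of classes 2 and 5.
  refine ⟨n + u.1.count 1 + u.1.count 4, (h.le_pow (n := n) ?_).trans_lt hn⟩
  have := Φ.le_count_zero_chain_const u (n + u.1.count 1 + u.1.count 4)
  omega

/-- Since `m ≤ 1`, a buffer below level `m` contains class 1, so superharmonicity holds wherever the
maximal inequality needs it. -/
theorem IsLyapunov.visitProb_lt_one (h : IsLyapunov ε s κ r) (h1 : pref.lt 1 0 2)
    (h4 : pref.lt 4 0 3) (hΦ : Φ.IsPriority pref) (he0 : 0 < ε) (he1 : ε < 2 / 9) {m : ℝ}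
    (hm0 : 0 < m) (hm1 : m ≤ 1) {u : Buffer fiveCycle}
    (hu : lyapunov s κ r (quarterPosition u) < m) :
    Φ.visitProb (fiveCyclePMF he0 he1) {w | m ≤ lyapunov s κ r (quarterPosition w)} u < 1 := by
  have hpos := fun w => lyapunov_pos h.s_pos h.κ_pos h.r_pos (quarterPosition w)
  have hset : {w | m ≤ lyapunov s κ r (quarterPosition w)} =
      {w | ENNReal.ofReal m ≤ ENNReal.ofReal (lyapunov s κ r (quarterPosition w))} := by
    ext w
    exact (ENNReal.ofReal_le_ofReal_iff (hpos w).le).symm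
  have hm : 0 < ENNReal.ofReal m := ENNReal.ofReal_pos.2 hm0
  rw [hset]
  refine (Φ.visitProb_le_div _
    (fun w : Buffer fiveCycle => ENNReal.ofReal (lyapunov s κ r (quarterPosition w)))
    hm.ne' ENNReal.ofReal_ne_top ?_ u).trans_lt ?_
  · intro w hw
    have hw0 : 0 ∈ w.1 := by
      by_contra hw0
      rw [ENNReal.ofReal_lt_ofReal_iff hm0] at hw
      linarith [h.one_le hw0]
    simp only [fiveCyclePMF_apply, ← ENNReal.ofReal_mul (fiveCycleMass_pos he0 he1 _).le]
    rw [← ENNReal.ofReal_sum_of_nonneg fun v _ =>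
      mul_nonneg (fiveCycleMass_pos he0 he1 v).le (hpos _).le]
    exact ENNReal.ofReal_le_ofReal (h.sum_le h1 h4 hΦ hw0)
  · rw [← ENNReal.ofReal_div_of_pos hm0, ENNReal.ofReal_lt_one, div_lt_one hm0]
    exact hu

theorem IsLyapunov.transient (h : IsLyapunov ε s κ r) (h1 : pref.lt 1 0 2)
    (h4 : pref.lt 4 0 3) (hΦ : Φ.IsPriority pref) (he0 : 0 < ε) (he1 : ε < 2 / 9) :
    Φ.Transient (fiveCyclePMF he0 he1) := by
  intro u
  refine lt_of_le_of_ne prob_le_one fun hone => ?_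
  -- The bound by 1 keeps class 1 present below level `m`; the other bound makes a visit to `u` a
  -- visit to level `m`.
  set m := min 1 (lyapunov s κ r (quarterPosition u)) with hm
  have hm0 : 0 < m := lt_min one_pos (lyapunov_pos h.s_pos h.κ_pos h.r_pos _)
  obtain ⟨n, hn⟩ := h.exists_lt Φ u hm0
  have hlt := h.visitProb_lt_one h1 h4 hΦ he0 he1 hm0 (min_le_left _ _) hn
  have heq := Φ.visitProb_chain_eq_one _ hone (ω := fun _ => 0)
    (fun _ => fiveCyclePMF_pos he0 he1 0) n
  refine (hlt.trans_le (heq.ge.trans (measure_mono ?_))).false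
  rintro ω ⟨k, hk⟩
  refine ⟨k, ?_⟩
  rw [Set.mem_singleton_iff.1 hk]
  exact min_le_right (1 : ℝ) (lyapunov s κ r (quarterPosition u))

theorem IsLyapunov.arrivalLaw_pos (h : IsLyapunov ε s κ r) (h1 : pref.lt 1 0 2)
    (h4 : pref.lt 4 0 3) (hΦ : Φ.IsPriority pref) (he0 : 0 < ε) (he1 : ε < 2 / 9)
    (u : Buffer fiveCycle) :
    0 < arrivalLaw (fiveCyclePMF he0 he1) {ω | ∃ N, ∀ n, N ≤ n → 0 ∈ (Φ.chain u ω n).1} := by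
  refine pos_iff_ne_zero.2 fun hzero => ?_
  obtain ⟨n, hn⟩ := h.exists_lt Φ u one_pos
  have hlt := h.visitProb_lt_one h1 h4 hΦ he0 he1 one_pos le_rfl hn
  have heq := Φ.arrivalLaw_eventually_mem_eq_zero (fiveCyclePMF he0 he1) {w | 0 ∈ w.1} hzero
    (ω := fun _ => 0) (fun _ => fiveCyclePMF_pos he0 he1 0) n
  set z := Φ.chain u (fun _ => 0) n
  set A := {ω : ℕ → Fin 5 | ∃ k, Φ.chain z ω k ∈
    {w | (1 : ℝ) ≤ lyapunov s κ r (quarterPosition w)}}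
  set B := {ω : ℕ → Fin 5 | ∃ N, ∀ k, N ≤ k → Φ.chain z ω k ∈ {w : Buffer fiveCycle | 0 ∈ w.1}}
  -- Losing class 1 forces the Lyapunov function up to at least 1.
  have hcover : Set.univ ⊆ A ∪ B := by
    intro ω _
    by_cases hω : ∀ k, 0 ∈ (Φ.chain z ω k).1
    · exact Or.inr ⟨0, fun k _ => hω k⟩
    · push Not at hω
      obtain ⟨k, hk⟩ := hω
      exact Or.inl ⟨k, h.one_le hk⟩
  have : (1 : ℝ≥0∞) ≤ arrivalLaw (fiveCyclePMF he0 he1) A + 0 := by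
    rw [← heq, ← measure_univ (μ := arrivalLaw (fiveCyclePMF he0 he1))]
    exact (measure_mono hcover).trans (measure_union_le _ _)
  rw [add_zero] at this
  exact (hlt.trans_le this).false

/-- The law of the jumps of the position. -/
theorem toReal_toMeasure_jump (he0 : 0 < ε) (he1 : ε < 2 / 9) (h1 : pref.lt 1 0 2)
    (h4 : pref.lt 4 0 3) (hΦ : Φ.IsPriority pref) {u : Buffer fiveCycle} (h0 : 0 ∈ u.1)
    (δ : ℤ × ℤ) :
    ((fiveCyclePMF he0 he1).toMeasure
      {v | quarterPosition (Φ.next u v) - quarterPosition u = δ}).toReal =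
      quarterJump ε (quarterPosition u).2 δ := by
  classical
  obtain ⟨d, hd, hd'⟩ := quarterPosition_next h1 h4 hΦ h0
  replace hd' := hd'.imp_right fun h => And.intro h.1.ne' h.2
  simp only [hd, add_sub_cancel_left]
  rw [toMeasure_fiveCyclePMF, ENNReal.toReal_ofReal]
  · simp only [Set.mem_ofPred_eq, Fin.sum_univ_five, quarterJump]
    by_cases e1 : δ = (1, 0)
    · subst e1
      rcases hd' with ⟨hy, rfl⟩ | ⟨hy, rfl | rfl⟩ <;>
        simp [hy, axisJump, leftJump, rightJump, fiveCycleMass]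
    by_cases e2 : δ = (-1, 0)
    · subst e2
      rcases hd' with ⟨hy, rfl⟩ | ⟨hy, rfl | rfl⟩ <;>
        simp [hy, axisJump, leftJump, rightJump, fiveCycleMass]
      ring
    by_cases e3 : δ = (0, 1)
    · subst e3
      rcases hd' with ⟨hy, rfl⟩ | ⟨hy, rfl | rfl⟩ <;>
        simp [hy, axisJump, leftJump, rightJump, fiveCycleMass]
    by_cases e4 : δ = (0, -1)
    · subst e4
      rcases hd' with ⟨hy, rfl⟩ | ⟨hy, rfl | rfl⟩ <;>
        simp [hy, axisJump, leftJump, rightJump, fiveCycleMass]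
      all_goals ring
    · rcases hd' with ⟨hy, rfl⟩ | ⟨hy, rfl | rfl⟩ <;>
        simp [e1, e2, e3, e4, axisJump, leftJump, rightJump, @eq_comm _ _ δ]
  · refine Finset.sum_nonneg fun i _ => ?_
    split_ifs
    exacts [(fiveCycleMass_pos he0 he1 i).le, le_rfl]

end Lyapunov

theorem mainTheorem6 :
    (∃ (pref : Preferences fiveCycle) (Φ : MatchingPolicy fiveCycle),
      pref.lt 1 0 2 ∧ pref.lt 4 0 3 ∧ Φ.IsPriority pref) ∧
    ∀ ε : ℝ, 0 < ε → ε < 2 / 9 →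
      ∃ μ : PMF (Fin 5),
        (∀ i, (μ i).toReal = fiveCycleMass ε i) ∧
        μ ∈ Ncond fiveCycle ∧
        ∀ (pref : Preferences fiveCycle) (Φ : MatchingPolicy fiveCycle),
          pref.lt 1 0 2 → pref.lt 4 0 3 → Φ.IsPriority pref →
            ¬ Φ.Stable μ ∧
            Φ.Transient μ ∧
            -- while an item of class 1 is present, the walk is the quarter-plane walk
            (∀ u : Buffer fiveCycle, 0 ∈ u.1 →
              (∀ i ∈ u.1, i = 0 ∨ i = 2 ∨ i = 3) ∧
              ∀ d : ℤ × ℤ,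
                (μ.toMeasure
                  {v | quarterPosition (Φ.next u v) - quarterPosition u = d}).toReal =
                  quarterJump ε (quarterPosition u).2 d) ∧
            -- with positive probability the walk ends up in this component for ever
            0 < arrivalLaw μ {ω | ∃ N, ∀ n, N ≤ n →
              0 ∈ (Φ.chain (Buffer.empty fiveCycle) ω n).1} := by
  refine ⟨⟨maxPreferences fiveCycle, maxPolicy fiveCycle,
    show (0 : Fin 5) < 2 by decide, show (0 : Fin 5) < 3 by decide,
    maxPolicy_isPriority fiveCycle⟩, fun ε he0 he1 => ?_⟩
  refine ⟨fiveCyclePMF he0 he1, fun i => ?_, fiveCyclePMF_mem_Ncond he0 he1,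
    fun pref Φ h1 h4 hΦ => ?_⟩
  · rw [fiveCyclePMF_apply, ENNReal.toReal_ofReal (fiveCycleMass_pos he0 he1 i).le]
  obtain ⟨s, κ, r, h⟩ := exists_isLyapunov he0 he1
  have htrans := h.transient h1 h4 hΦ he0 he1
  exact ⟨htrans.not_stable, htrans,
    fun u hu => ⟨Buffer.mem_of_zero_mem hu, toReal_toMeasure_jump he0 he1 h1 h4 hΦ hu⟩,
    h.arrivalLaw_pos h1 h4 hΦ he0 he1 (Buffer.empty fiveCycle)⟩
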